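/- Let $G=(V,E)$ be a finite simple graph with at least one vertex, and let $k>0$ be an integer. An *oriented (vertex) separation* of $G$ is a pair $(A,B)$ with $A\cup B=V$ such that $G$ has no edge between $A\smallsetminus B$ and $B\smallsetminus A$; its *inverse* is $(A,B)^*=(B,A)$, its *order* is $|A\cap B|$, and $(A,B)\le(C,D)$ means $A\subseteq C$ and $B\supseteq D$. Let $\vec S_k$ be the set of oriented separations of order less than $k$, and $S_k$ the set of the unoriented separations $\{s,s^*\}$ with $s\in\vec S_k$. A *star* is a non-empty set $\sigma$ of oriented separations such that $r\le s^*$ for all distinct $r,s\in\sigma$. Let $\mathcal F_k$ be the set of all stars $\sigma\subseteq\vec S_k$ with $\bigl|\bigcap_{(A,B)\in\sigma}B\bigr|<k$. An *$\mathcal F_k$-tangle of $S_k$* is a set $O\subseteq\vec S_k$ such that (a) $O$ contains exactly one element of $\{s,s^*\}$ for every $s\in\vec S_k$; (b) there are no $r,s\in\vec S_k$ with $\{r,r^*\}\ne\{s,s^*\}$, $r<s$ and $r^*,s\in O$; (c) no subset of $O$ lies in $\mathcal F_k$. An *$S_k$-tree over $\mathcal F_k$* is a finite tree $T$ with at least one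 edge together with a map $\alpha$ from the set of oriented edges $(x,y)$ of $T$ (with $xy\in E(T)$) to $\vec S_k$ such that $\alpha(y,x)=\alpha(x,y)^*$ for every edge $xy$ and $\{\alpha(x,t): xt\in E(T)\}\in\mathcal F_k$ for every node $t$ of $T$. A *bramble* in $G$ is a set of non-empty connected vertex sets any two of which touch, i.e. share a vertex or are joined by an edge of $G$; its *order* is the least size of a set of vertices meeting all its elements. A *tree-decomposition* of $G$ is a finite tree $T$ with a family $(V_t)_{t\in T}$ of subsets of $V$ such that every vertex and both ends of every edge of $G$ lie in some $V_t$, and $V_{t_1}\cap V_{t_3}\subseteq V_{t_2}$ whenever $t_2$ lies on the path from $t_1$ to $t_3$ in $T$. Its *width* is $\max_t|V_t|-1$, and the *tree-width* of $G$ is the least width of its tree-decompositions. **Theorem.** The following assertions are equivalent: 1. $G$ has a bramble of order at least $k$. 2. $G$ has an $\mathcal F_k$-tangle of $S_k$. 3. $G$ has no $S_k$-tree over $\mathcal F_k$. 4. $G$ has tree-width at least $k-1$. -/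

import Mathlib

namespace TangleDuality

/-! ### Abstract separation systems -/

/-- A separation system: a partially ordered set with an order-reversing involution. -/
class SeparationSystem (U : Type*) extends PartialOrder U where
  /-- the inverse of an oriented separation -/
  inv : U → U
  inv_inv : ∀ s, inv (inv s) = s
  inv_le_inv_iff : ∀ r s, inv r ≤ inv s ↔ s ≤ r

section Abstract

open SeparationSystem

variable {U : Type*} [SeparationSystem U]

/- In what follows a set `S : Set U` that is closed under inverses is a set of oriented separations,
with the induced order and involution; the unoriented separation of `s` is `{s, inv s}`. -/

/-- `O` is an orientation of `S`: a subset of `S` that contains exactly one element of `{s, inv s}`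
for every `s ∈ S`. -/
def IsOrientation (S O : Set U) : Prop :=
  O ⊆ S ∧ ∀ s ∈ S, ∃! x, x ∈ ({s, inv s} : Set U) ∧ x ∈ O

/-- `O` is consistent in `S`: there are no two distinct separations `{r, inv r} ≠ {s, inv s}` in `S`
with `r < s` and `inv r, s ∈ O`. -/
def IsConsistent (S O : Set U) : Prop :=
  ∀ r ∈ S, ∀ s ∈ S, ({r, inv r} : Set U) ≠ {s, inv s} → r < s → ¬ (inv r ∈ O ∧ s ∈ O)

/-- A star of separations: a nonempty set of oriented separations pointing towards each other. -/
def IsStar (σ : Set U) : Prop :=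
  σ.Nonempty ∧ ∀ r ∈ σ, ∀ s ∈ σ, r ≠ s → r ≤ inv s

/-- `O` is an `F`-tangle of `S`: a consistent orientation of `S` with no subset in `F`. -/
def IsTangle (S : Set U) (F : Set (Set U)) (O : Set U) : Prop :=
  IsOrientation S O ∧ IsConsistent S O ∧ ∀ σ ⊆ O, σ ∉ F

/-- An `S`-tree on the graph `T`: `T` is a tree with at least one edge, and `α` maps the
oriented edges of `T` to `S`, commuting with inversion. -/
structure SepTree (S : Set U) {N : Type*} (T : SimpleGraph N) where
  isTree : T.IsTree
  exists_edge : ∃ x y, T.Adj x y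
  /-- the oriented separation of an oriented edge -/
  α : T.Dart → U
  mem : ∀ e, α e ∈ S
  map_symm : ∀ e : T.Dart, α e.symm = inv (α e)

/-- An `S`-tree is over `F` if for every node `t` the image of the set of edges oriented towards `t`
belongs to `F`. -/
def SepTree.IsOver {S : Set U} {N : Type*} {T : SimpleGraph N} (τ : SepTree S T)
    (F : Set (Set U)) : Prop :=
  ∀ t : N, τ.α '' {e : T.Dart | e.snd = t} ∈ F

/-- There is a (finite) `S`-tree over `F`. -/
def HasSepTreeOver (S : Set U) (F : Set (Set U)) : Prop :=
  ∃ (N : Type) (_ : Fintype N) (T : SimpleGraph N) (τ : SepTree S T), τ.IsOver F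

end Abstract

section Graph

variable {V : Type*}

/-! ### Vertex separations of a graph -/

/-- An oriented vertex separation `(A, B)` of `G`: `A ∪ B = V`, and `G` has no edge between
`A \ B` and `B \ A`. -/
@[ext]
structure VertexSep (G : SimpleGraph V) where
  /-- the first side -/
  A : Set V
  /-- the second side, to which the separation points -/
  B : Set V
  union_eq : A ∪ B = Set.univ
  not_adj : ∀ a ∈ A \ B, ∀ b ∈ B \ A, ¬ G.Adj a b

/-- The order is `(A, B) ≤ (C, D) ↔ A ⊆ C ∧ D ⊆ B`, and the inverse of `(A, B)` is `(B, A)`. -/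
instance (G : SimpleGraph V) : SeparationSystem (VertexSep G) where
  le s t := s.A ⊆ t.A ∧ t.B ⊆ s.B
  le_refl _ := ⟨subset_rfl, subset_rfl⟩
  le_trans _ _ _ h₁ h₂ := ⟨h₁.1.trans h₂.1, h₂.2.trans h₁.2⟩
  le_antisymm _ _ h₁ h₂ :=
    VertexSep.ext (Set.Subset.antisymm h₁.1 h₂.1) (Set.Subset.antisymm h₂.2 h₁.2)
  inv s := ⟨s.B, s.A, by rw [Set.union_comm]; exact s.union_eq,
    fun a ha b hb hab => s.not_adj b hb a ha hab.symm⟩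
  inv_inv _ := rfl
  inv_le_inv_iff _ _ := And.comm

/-- The order `|A ∩ B|` of a vertex separation (of a finite graph). -/
noncomputable def VertexSep.order {G : SimpleGraph V} (s : VertexSep G) : ℕ :=
  (s.A ∩ s.B).ncard

/-- The set `S_k` of the oriented vertex separations of `G` of order less than `k`. -/
def sepsLT (G : SimpleGraph V) (k : ℕ) : Set (VertexSep G) :=
  {s | s.order < k}

/-- The set `F_k` of the stars in `S_k` whose second sides have fewer than `k` common vertices. -/
def forbiddenStars (G : SimpleGraph V) (k : ℕ) : Set (Set (VertexSep G)) :=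
  {σ | σ ⊆ sepsLT G k ∧ IsStar σ ∧ (⋂ s ∈ σ, s.B).ncard < k}

/-! ### Brambles -/

/-- Two vertex sets touch if they share a vertex or there is an edge between them. -/
def Touch (G : SimpleGraph V) (C D : Set V) : Prop :=
  (C ∩ D).Nonempty ∨ ∃ c ∈ C, ∃ d ∈ D, G.Adj c d

/-- A bramble: a set of mutually touching (nonempty) connected vertex sets. -/
def IsBramble (G : SimpleGraph V) (ℬ : Set (Set V)) : Prop :=
  (∀ C ∈ ℬ, (G.induce C).Connected) ∧ ∀ C ∈ ℬ, ∀ D ∈ ℬ, Touch G C D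

/-- `X` covers `ℬ` if it meets every element of `ℬ`. -/
def Covers (X : Set V) (ℬ : Set (Set V)) : Prop :=
  ∀ C ∈ ℬ, (X ∩ C).Nonempty

/-- The order of a bramble (of a finite graph): the least size of a vertex set covering it. -/
noncomputable def brambleOrder (ℬ : Set (Set V)) : ℕ :=
  sInf {n | ∃ X : Set V, Covers X ℬ ∧ X.ncard = n}

/-- The whole vertex set covers every bramble, so the minimum in `brambleOrder` is over a
nonempty set. -/
theorem IsBramble.covers_univ {G : SimpleGraph V} {ℬ : Set (Set V)} (h : IsBramble G ℬ) :
    Covers Set.univ ℬ := by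
  intro C hC
  obtain ⟨v⟩ := (h.1 C hC).nonempty
  exact ⟨v.1, trivial, v.2⟩

/-! ### Tree-decompositions -/

/-- A tree-decomposition of `G` with decomposition tree `T`. -/
structure TreeDecomposition (G : SimpleGraph V) {N : Type*} (T : SimpleGraph N) where
  isTree : T.IsTree
  /-- the parts -/
  bag : N → Set V
  exists_mem_bag : ∀ v : V, ∃ t, v ∈ bag t
  exists_edge_bag : ∀ u v : V, G.Adj u v → ∃ t, u ∈ bag t ∧ v ∈ bag t
  inter_subset : ∀ (t₁ t₂ t₃ : N) (p : T.Walk t₁ t₃), p.IsPath → t₂ ∈ p.support →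
    bag t₁ ∩ bag t₃ ⊆ bag t₂

/-- The width: the largest size of a part, minus one. -/
noncomputable def TreeDecomposition.width {G : SimpleGraph V} {N : Type*} [Fintype N]
    {T : SimpleGraph N} (D : TreeDecomposition G T) : ℤ :=
  ((Finset.univ.sup fun t => (D.bag t).ncard : ℕ) : ℤ) - 1

/-- The tree-width of a finite graph: the least width of its (finite) tree-decompositions. -/
noncomputable def treeWidth (G : SimpleGraph V) : ℤ :=
  sInf {w | ∃ (N : Type) (_ : Fintype N) (T : SimpleGraph N) (D : TreeDecomposition G T),
    D.width = w}

/-- The set of widths is bounded below. -/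
theorem bddBelow_widths (G : SimpleGraph V) :
    BddBelow {w | ∃ (N : Type) (_ : Fintype N) (T : SimpleGraph N) (D : TreeDecomposition G T),
      D.width = w} := by
  refine ⟨-1, ?_⟩
  rintro w ⟨N, _, T, D, rfl⟩
  simp only [TreeDecomposition.width]
  omega

/-- Every graph has a tree-decomposition with a single part. -/
theorem nonempty_widths (G : SimpleGraph V) :
    {w | ∃ (N : Type) (_ : Fintype N) (T : SimpleGraph N) (D : TreeDecomposition G T),
      D.width = w}.Nonempty :=
  ⟨_, Unit, inferInstance, ⊥,
    { isTree := SimpleGraph.IsTree.of_subsingleton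
      bag := fun _ => Set.univ
      exists_mem_bag := fun _ => ⟨(), trivial⟩
      exists_edge_bag := fun _ _ _ => ⟨(), trivial, trivial⟩
      inter_subset := fun _ _ _ _ _ _ _ _ => trivial }, rfl⟩

end Graph

end TangleDuality

/-!
A bramble of order at least `k` orients every separation of order less than `k`, towards the side
of an element that avoids the separator, and these orientations form a tangle. Conversely, the
connected sets to which a tangle points touch by consistency. A set `X` of fewer than `k` vertices
cannot cover them: the components of `G - X` give a star with interior `X`, so the tangle points to
one of them.

A tangle leaves no room for an `S_k`-tree, because a tree has more nodes than edges, and a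
tree-decomposition of width less than `k - 1` yields an `S_k`-tree over `F_k` by cutting `G` along
the edges of the decomposition tree.

The remaining implication, that large tree-width forces a tangle, is an instance of abstract
tangle-tree duality. Take a maximal lower set `P` of separations such that no tree over the stars in
`F_k` has all its other leaves in `P`. If neither `s` nor `inv s` lies in `P`, then enlarging `P` by
a minimal separation `r ≤ s`, and by a minimal `t ≤ inv s`, admits such trees. Rerooting the trees
at the new leaves and shifting both of them onto a separation of minimal order between `r` and
`inv t` gives a tree for `P` itself; by submodularity shifting does not increase orders. So `P` is a
tangle, unless there is an `S_k`-tree already for `P = ∅`, in which case the interiors of its stars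
glue to a tree-decomposition of width less than `k - 1`.
-/

namespace TangleDuality

open SeparationSystem (inv)
open Set

/-! ### Tangles and trees in abstract separation systems -/

section Tangles

variable {U : Type*} [SeparationSystem U] {S O P : Set U} {F : Set (Set U)} {r s : U}

theorem inv_le_inv (h : r ≤ s) : inv s ≤ inv r :=
  (SeparationSystem.inv_le_inv_iff s r).2 h

theorem le_inv_comm : r ≤ inv s ↔ s ≤ inv r := by
  rw [← SeparationSystem.inv_le_inv_iff, SeparationSystem.inv_inv]

theorem inv_le_comm : inv r ≤ s ↔ inv s ≤ r := by
  rw [← SeparationSystem.inv_le_inv_iff, SeparationSystem.inv_inv]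

theorem IsOrientation.mem_or_inv_mem (h : IsOrientation S O) (hs : s ∈ S) : s ∈ O ∨ inv s ∈ O := by
  obtain ⟨x, ⟨rfl | rfl, hx⟩, -⟩ := h.2 s hs
  exacts [.inl hx, .inr hx]

theorem IsOrientation.inv_eq_self (h : IsOrientation S O) (hs : s ∈ O) (hs' : inv s ∈ O) :
    inv s = s :=
  (h.2 s (h.1 hs)).unique ⟨.inr rfl, hs'⟩ ⟨.inl rfl, hs⟩

/-- `F` is standard for `S` if it forces every small separation of `S`: an orientation of `S` with
no subset in `F` cannot contain the inverse of a separation `s ≤ inv s`. -/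
def IsStandard (S : Set U) (F : Set (Set U)) : Prop :=
  ∀ s ∈ S, s ≤ inv s → {inv s} ∈ F

/-- `P` is a lower set of the partially ordered set `S`. -/
def IsLowerIn (S P : Set U) : Prop :=
  P ⊆ S ∧ ∀ p ∈ P, ∀ q ∈ S, q ≤ p → q ∈ P

theorem IsLowerIn.insert (hP : IsLowerIn S P) (hs : Minimal (· ∈ {t ∈ S \ P | t ≤ r}) s) :
    IsLowerIn S (insert s P) := by
  refine ⟨insert_subset hs.prop.1.1 hP.1, ?_⟩
  rintro p (rfl | hp) q hq hqp
  · by_cases hqP : q ∈ P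
    · exact .inr hqP
    · exact .inl (hs.eq_of_le ⟨⟨hq, hqP⟩, hqp.trans hs.prop.2⟩ hqp)
  · exact .inr (hP.2 p hp q hq hqp)

theorem IsLowerIn.isTangle (hP : IsLowerIn S P) (hmem : ∀ s ∈ S, s ∈ P ∨ inv s ∈ P)
    (hinv : ∀ s ∈ P, inv s ∉ P) (hF : ∀ σ ⊆ P, σ ∉ F) : IsTangle S F P := by
  refine ⟨⟨hP.1, fun s hs => ?_⟩, fun r hr s _ _ hrs h => ?_, hF⟩
  · rcases hmem s hs with h | h
    · refine ⟨s, ⟨.inl rfl, h⟩, ?_⟩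
      rintro _ ⟨rfl | rfl, hx⟩
      exacts [rfl, absurd hx (hinv s h)]
    · refine ⟨inv s, ⟨.inr rfl, h⟩, ?_⟩
      rintro _ ⟨rfl | rfl, hx⟩
      exacts [absurd h (hinv _ hx), rfl]
  · exact hinv r (hP.2 s h.2 r hr hrs.le) h.1

theorem IsTangle.not_inv_le (h : IsTangle S F O) (hF : IsStandard S F) (hS : ∀ s ∈ S, inv s ∈ S)
    (hs : s ∈ O) : ¬ inv s ≤ s := fun hle =>
  h.2.2 {s} (singleton_subset_iff.2 hs) <| by
    have hsmall : inv s ≤ inv (inv s) := hle.trans_eq (SeparationSystem.inv_inv s).symm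
    simpa only [SeparationSystem.inv_inv] using hF (inv s) (hS s (h.1.1 hs)) hsmall

theorem IsTangle.mem_of_le_inv (h : IsTangle S F O) (hF : IsStandard S F)
    (hS : ∀ s ∈ S, inv s ∈ S) (hs : s ∈ S) (hle : s ≤ inv s) : s ∈ O :=
  (h.1.mem_or_inv_mem hs).resolve_right fun hs' =>
    h.not_inv_le hF hS hs' (by rwa [SeparationSystem.inv_inv])

theorem IsTangle.not_le (h : IsTangle S F O) (hF : IsStandard S F) (hS : ∀ s ∈ S, inv s ∈ S)
    (hr : inv r ∈ O) (hs : s ∈ O) : ¬ r ≤ s := by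
  intro hle
  by_cases heq : ({r, inv r} : Set U) = {s, inv s}
  · refine h.not_inv_le hF hS hs ?_
    rcases heq.subset (mem_insert r _) with rfl | rfl
    · exact (h.1.inv_eq_self hs hr).le
    · exact hle
  · have hrS : r ∈ S := SeparationSystem.inv_inv r ▸ hS _ (h.1.1 hr)
    exact h.2.1 r hrS s (h.1.1 hs) heq (hle.lt_of_ne fun hrs => heq (by rw [hrs])) ⟨hr, hs⟩

/-- At every node of an `S`-tree over `F`, a tangle omits the separation of some edge towards that
node. A tree has more nodes than edges, so both orientations of some edge are omitted. -/
theorem IsTangle.not_hasSepTreeOver (h : IsTangle S F O) : ¬ HasSepTreeOver S F := by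
  classical
  rintro ⟨N, _, T, τ, hτ⟩
  have exists_omitted : ∀ t : N, ∃ e : T.Dart, e.snd = t ∧ τ.α e ∉ O := by
    intro t
    by_contra! hcon
    refine h.2.2 _ ?_ (hτ t)
    rintro _ ⟨e, he, rfl⟩
    exact hcon e he
  choose e he heO using exists_omitted
  obtain ⟨t, -, t', -, hne, heq⟩ := Finset.exists_ne_map_eq_of_card_lt_of_maps_to
    (s := Finset.univ) (t := T.edgeFinset) (f := fun t => (e t).edge)
    (by have := τ.isTree.card_edgeFinset; rw [Finset.card_univ]; omega)
    (fun t _ => by simp)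
  rcases (SimpleGraph.dart_edge_eq_iff _ _).1 heq with hsame | hsymm
  · exact hne (by rw [← he t, ← he t', hsame])
  · rcases h.1.mem_or_inv_mem (τ.mem (e t')) with hmem | hmem
    · exact heO t' hmem
    · exact heO t (by rwa [hsymm, τ.map_symm])

end Tangles

section Decomposable

variable {U : Type*} [SeparationSystem U] {S P σ : Set U} {F : Set (Set U)} {s u : U}

/-- `u` is decomposable into `P` by `F`: there is an `S`-tree that is rooted at a leaf associated
with `u`, whose other nodes are associated with stars in `F` or are leaves associated with elements
of `P`. The tree is encoded by its recursive structure: `R` consists of the separations of the edges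
below the root edge. -/
inductive Decomposable (F : Set (Set U)) (P : Set U) : U → Prop
  | of_mem {u : U} (hu : u ∈ P) : Decomposable F P u
  | of_star {u : U} (R : Set U) (hR : ∀ r ∈ R, Decomposable F P r) (hle : ∀ r ∈ R, r ≤ u)
      (hF : insert (inv u) R ∈ F) : Decomposable F P u

/-- Some separation is decomposable into `P` from both of its sides: two rooted trees that together
form an `S`-tree over `F`, up to leaves associated with elements of `P`. -/
def IsDecomposing (F : Set (Set U)) (P : Set U) : Prop :=
  ∃ r, Decomposable F P r ∧ Decomposable F P (inv r)

theorem isDecomposing_of_subset (hσ : IsStar σ) (hF : σ ∈ F) (hP : σ ⊆ P) : IsDecomposing F P := by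
  obtain ⟨r, hr⟩ := hσ.1
  refine ⟨r, .of_mem (hP hr), .of_star (σ \ {r}) (fun t ht => .of_mem (hP ht.1))
    (fun t ht => hσ.2 t ht.1 r hr ht.2) ?_⟩
  rwa [SeparationSystem.inv_inv, insert_sdiff_singleton, insert_eq_of_mem hr]

/-- A tree that uses the leaf `s` can be rerooted there, once a tree beyond its root is given. -/
theorem Decomposable.or_reroot (hF : ∀ σ ∈ F, IsStar σ) (h : Decomposable F (insert s P) u) :
    Decomposable F P u ∨
      (Decomposable F (insert s P) (inv u) → Decomposable F (insert s P) (inv s)) := by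
  induction h with
  | of_mem hu =>
    rcases hu with rfl | hu
    exacts [.inr id, .inl (.of_mem hu)]
  | @of_star u R hR hle hσ ih =>
    by_cases hRP : ∀ r ∈ R, Decomposable F P r
    · exact .inl (.of_star R hRP hle hσ)
    push Not at hRP
    obtain ⟨r, hr, hrP⟩ := hRP
    refine .inr fun hu => (ih r hr).resolve_left hrP ?_
    refine .of_star (insert (inv u) (R \ {r})) ?_ ?_ ?_
    · rintro t (rfl | ht)
      exacts [hu, hR t ht.1]
    · rintro t (rfl | ht)
      · exact inv_le_inv (hle r hr)
      · exact (hF _ hσ).2 t (.inr ht.1) r (.inr hr) ht.2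
    · rwa [SeparationSystem.inv_inv, insert_comm, insert_sdiff_singleton, insert_eq_of_mem hr]

theorem IsDecomposing.decomposable_inv (hF : ∀ σ ∈ F, IsStar σ) (h : IsDecomposing F (insert s P))
    (hP : ¬ IsDecomposing F P) : Decomposable F (insert s P) (inv s) := by
  obtain ⟨r, hr, hr'⟩ := h
  rcases hr.or_reroot hF with h₁ | h₁
  · rcases hr'.or_reroot hF with h₂ | h₂
    · exact absurd ⟨r, h₁, h₂⟩ hP
    · exact h₂ (by rwa [SeparationSystem.inv_inv])
  · exact h₁ hr'

end Decomposable

/-! ### Tangle-tree duality in universes of separations -/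

/-- A universe of separations: a separation system that is a lattice. -/
class SeparationUniverse (U : Type*) extends SeparationSystem U, Lattice U

section Duality

variable {U : Type*} [SeparationUniverse U] {S P : Set U} {F : Set (Set U)} {s t u x : U}

/-- `x` emulates `s` in `S`: every `w` in `S` that lies below `inv s` stays in `S` when it is
shifted to `w ⊓ inv x`, below `inv x`. -/
def Emulates (S : Set U) (s x : U) : Prop :=
  s ≤ x ∧ ∀ w ∈ S, w ≤ inv s → w ⊓ inv x ∈ S

/-- `S` is separable: between any two comparable elements there is a separation that emulates
the lower one from above and whose inverse emulates the inverse of the upper one. -/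
def IsSeparable (S : Set U) : Prop :=
  ∀ s ∈ S, ∀ t ∈ S, s ≤ t → ∃ x, Emulates S s x ∧ Emulates S (inv t) (inv x)

/-- `F` is closed under shifting in `S`: if `x` emulates `s`, then shifting below `inv x` turns
every star in `F` at a node of an `S`-tree whose edge towards the root is associated with a
separation `u ≤ inv s` into a star in `F`. -/
def IsClosedUnderShifting (S : Set U) (F : Set (Set U)) : Prop :=
  ∀ s x, Emulates S s x → ∀ u R, u ≤ inv s → (∀ r ∈ R, r ≤ u) → insert (inv u) R ∈ F →
    insert (inv (u ⊓ inv x)) ((· ⊓ inv x) '' R) ∈ F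

/-- Shifting turns a leaf `s` into a small separation, for which a standard `F` has a singleton
star. -/
theorem Decomposable.shift (hstd : IsStandard S F) (hshift : IsClosedUnderShifting S F)
    (hP : IsLowerIn S P) (hs : s ∈ S) (hx : Emulates S s x)
    (h : Decomposable F (insert s P) u) (hu : u ≤ inv s) : Decomposable F P (u ⊓ inv x) := by
  induction h with
  | of_mem hmem =>
    rcases hmem with rfl | hmem
    · refine .of_star ∅ (by simp) (by simp) ?_
      rw [insert_empty_eq]
      exact hstd _ (hx.2 _ hs hu)
        (inf_le_left.trans (hx.1.trans (le_inv_comm.1 inf_le_right)))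
    · exact .of_mem (hP.2 _ hmem _ (hx.2 _ (hP.1 hmem) hu) inf_le_left)
  | of_star R _ hle hσ ih =>
    refine .of_star ((· ⊓ inv x) '' R) ?_ ?_ (hshift s x hx _ R hu hle hσ)
    · rintro _ ⟨r, hr, rfl⟩
      exact ih r hr ((hle r hr).trans hu)
    · rintro _ ⟨r, hr, rfl⟩
      exact inf_le_inf_right _ (hle r hr)

theorem mem_or_inv_mem_of_maximal (hfin : S.Finite) (hinv : ∀ s ∈ S, inv s ∈ S)
    (hsep : IsSeparable S) (hstar : ∀ σ ∈ F, IsStar σ) (hstd : IsStandard S F)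
    (hshift : IsClosedUnderShifting S F)
    (hP : Maximal (· ∈ {P | IsLowerIn S P ∧ ¬ IsDecomposing F P}) P) (hs : s ∈ S) :
    s ∈ P ∨ inv s ∈ P := by
  by_contra! hsP
  have exists_decomposable : ∀ r ∈ S, r ∉ P →
      ∃ t ∈ S, t ≤ r ∧ Decomposable F (insert t P) (inv t) := by
    intro r hr hrP
    obtain ⟨t, ht⟩ := (hfin.subset fun t ht => ht.1.1 : {t ∈ S \ P | t ≤ r}.Finite).exists_minimal
      ⟨r, ⟨hr, hrP⟩, le_rfl⟩
    have hdec : IsDecomposing F (insert t P) := by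
      by_contra hdec
      exact ht.prop.1.2 (hP.le_of_ge ⟨hP.prop.1.insert ht, hdec⟩ (subset_insert t P)
        (mem_insert t P))
    exact ⟨t, ht.prop.1.1, ht.prop.2, hdec.decomposable_inv hstar hP.prop.2⟩
  obtain ⟨r, hr, hrs, hdr⟩ := exists_decomposable s hs hsP.1
  obtain ⟨t, ht, hts, hdt⟩ := exists_decomposable (inv s) (hinv s hs) hsP.2
  obtain ⟨x, hrx, hxt⟩ := hsep r hr (inv t) (hinv t ht) (hrs.trans (le_inv_comm.1 hts))
  rw [SeparationSystem.inv_inv] at hxt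
  refine hP.prop.2 ⟨x, ?_, ?_⟩
  · have := hdt.shift hstd hshift hP.prop.1 ht hxt le_rfl
    rwa [SeparationSystem.inv_inv, inf_eq_right.2 (le_inv_comm.1 hxt.1)] at this
  · have := hdr.shift hstd hshift hP.prop.1 hr hrx le_rfl
    rwa [inf_eq_right.2 (inv_le_inv hrx.1)] at this

theorem exists_isTangle (hfin : S.Finite) (hinv : ∀ s ∈ S, inv s ∈ S) (hsep : IsSeparable S)
    (hstar : ∀ σ ∈ F, IsStar σ) (hstd : IsStandard S F) (hshift : IsClosedUnderShifting S F)
    (h : ¬ IsDecomposing F ∅) : ∃ O, IsTangle S F O := by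
  obtain ⟨P, hP⟩ := (hfin.finite_subsets.subset fun P hP => hP.1.1 :
    {P | IsLowerIn S P ∧ ¬ IsDecomposing F P}.Finite).exists_maximal
    ⟨∅, ⟨empty_subset S, by simp⟩, h⟩
  exact ⟨P, hP.prop.1.isTangle
    (fun s hs => mem_or_inv_mem_of_maximal hfin hinv hsep hstar hstd hshift hP hs)
    (fun s hs hs' => hP.prop.2 ⟨s, .of_mem hs, .of_mem hs'⟩)
    (fun σ hσP hσ => hP.prop.2 (isDecomposing_of_subset (hstar σ hσ) hσ hσP))⟩

/-- A separation of least order between `s` and `t` emulates both. -/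
theorem isSeparable_of_submodular (o : U → ℕ) (hinv : ∀ s, o (inv s) = o s)
    (hsub : ∀ s t, o (s ⊓ t) + o (s ⊔ t) ≤ o s + o t) (k : ℕ) : IsSeparable {s | o s < k} := by
  intro s _ t _ hst
  obtain ⟨x, ⟨hsx, hxt⟩, hmin⟩ := exists_minimalFor_of_wellFoundedLT (· ∈ Icc s t) o
    ⟨s, le_rfl, hst⟩
  replace hmin : ∀ y, s ≤ y → y ≤ t → o x ≤ o y := fun y hsy hyt =>
    (le_total (o x) (o y)).elim id (hmin ⟨hsy, hyt⟩)
  refine ⟨x, ⟨hsx, fun w hw hws => ?_⟩, inv_le_inv hxt, fun w hw hwt => ?_⟩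
  · have hle : o x ≤ o (w ⊔ inv x) := by
      rw [← hinv (w ⊔ inv x)]
      exact hmin _ (le_inv_comm.1 (sup_le hws (inv_le_inv hsx)))
        ((inv_le_comm.1 le_sup_right).trans hxt)
    have := hsub w (inv x)
    rw [hinv] at this
    simp only [mem_ofPred_eq] at hw ⊢
    omega
  · rw [SeparationSystem.inv_inv] at hwt ⊢
    have hle : o x ≤ o (w ⊔ x) := hmin _ (hsx.trans le_sup_right) (sup_le hwt hxt)
    have := hsub w x
    simp only [mem_ofPred_eq] at hw ⊢
    omega

end Duality

/-! ### The universe of vertex separations -/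

section VertexSep

variable {V : Type*} {G : SimpleGraph V}

namespace VertexSep

@[simp] theorem inv_A (s : VertexSep G) : (inv s).A = s.B := rfl

@[simp] theorem inv_B (s : VertexSep G) : (inv s).B = s.A := rfl

@[simp] theorem order_inv (s : VertexSep G) : (inv s).order = s.order := by
  simp only [order, inv_A, inv_B, inter_comm]

theorem mem_B_of_notMem_A (s : VertexSep G) {v : V} (h : v ∉ s.A) : v ∈ s.B :=
  (s.union_eq.symm ▸ mem_univ v : v ∈ s.A ∪ s.B).resolve_left h

theorem mem_A_of_notMem_B (s : VertexSep G) {v : V} (h : v ∉ s.B) : v ∈ s.A :=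
  (s.union_eq.symm ▸ mem_univ v : v ∈ s.A ∪ s.B).resolve_right h

theorem mem_A_of_adj (s : VertexSep G) {v w : V} (hv : v ∉ s.B) (h : G.Adj v w) : w ∈ s.A := by
  by_contra hw
  exact s.not_adj v ⟨s.mem_A_of_notMem_B hv, hv⟩ w ⟨s.mem_B_of_notMem_A hw, hw⟩ h

instance [Finite V] : Finite (VertexSep G) :=
  Finite.of_injective (fun s : VertexSep G => (s.A, s.B)) fun _ _ h =>
    VertexSep.ext (congrArg Prod.fst h) (congrArg Prod.snd h)

instance : Min (VertexSep G) where
  min s t :=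
    { A := s.A ∩ t.A
      B := s.B ∪ t.B
      union_eq := eq_univ_of_forall fun v => by
        by_cases hs : v ∈ s.B
        · exact .inr (.inl hs)
        by_cases ht : v ∈ t.B
        · exact .inr (.inr ht)
        exact .inl ⟨s.mem_A_of_notMem_B hs, t.mem_A_of_notMem_B ht⟩
      not_adj := by
        rintro a ⟨-, ha⟩ b ⟨-, hb⟩ hab
        exact hb ⟨s.mem_A_of_adj (fun h => ha (.inl h)) hab,
          t.mem_A_of_adj (fun h => ha (.inr h)) hab⟩ }

instance : Max (VertexSep G) where
  max s t := inv (inv s ⊓ inv t)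

@[simp] theorem inf_A (s t : VertexSep G) : (s ⊓ t).A = s.A ∩ t.A := rfl

@[simp] theorem inf_B (s t : VertexSep G) : (s ⊓ t).B = s.B ∪ t.B := rfl

@[simp] theorem sup_A (s t : VertexSep G) : (s ⊔ t).A = s.A ∪ t.A := rfl

@[simp] theorem sup_B (s t : VertexSep G) : (s ⊔ t).B = s.B ∩ t.B := rfl

instance : SeparationUniverse (VertexSep G) where
  inf := (· ⊓ ·)
  sup := (· ⊔ ·)
  inf_le_left _ _ := ⟨inter_subset_left, subset_union_left⟩
  inf_le_right _ _ := ⟨inter_subset_right, subset_union_right⟩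
  le_inf _ _ _ h₁ h₂ := ⟨subset_inter h₁.1 h₂.1, union_subset h₁.2 h₂.2⟩
  le_sup_left _ _ := ⟨subset_union_left, inter_subset_left⟩
  le_sup_right _ _ := ⟨subset_union_right, inter_subset_right⟩
  sup_le _ _ _ h₁ h₂ := ⟨union_subset h₁.1 h₂.1, subset_inter h₁.2 h₂.2⟩

theorem order_inf_add_order_sup_le [Finite V] (s t : VertexSep G) :
    (s ⊓ t).order + (s ⊔ t).order ≤ s.order + t.order := by
  unfold order
  rw [← ncard_union_add_ncard_inter, ← ncard_union_add_ncard_inter (s.A ∩ s.B)]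
  refine add_le_add (ncard_le_ncard ?_ (toFinite _)) (ncard_le_ncard ?_ (toFinite _)) <;>
  · intro v
    simp only [inf_A, inf_B, sup_A, sup_B, mem_union, mem_inter_iff]
    tauto

/-- For a set `R` of separations below `u`, the separation whose first side is that of `u` and whose
second side is the intersection of the second sides of the elements of `R`. Its order is the size of
the interior of the star `insert (inv u) R`. -/
def ofStar (u : VertexSep G) (R : Set (VertexSep G)) (hR : ∀ r ∈ R, r ≤ u) : VertexSep G where
  A := u.A
  B := ⋂ r ∈ R, r.B
  union_eq := eq_univ_of_forall fun v => by
    by_cases h : v ∈ u.A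
    · exact .inl h
    · exact .inr (mem_iInter₂.2 fun r hr => (hR r hr).2 (u.mem_B_of_notMem_A h))
  not_adj := by
    rintro a ⟨-, ha⟩ b ⟨-, hb⟩ hab
    simp only [mem_iInter, not_forall] at ha
    obtain ⟨r, hr, har⟩ := ha
    exact hb ((hR r hr).1 (r.mem_A_of_adj har hab))

end VertexSep

/-! ### The stars with small interior -/

section ForbiddenStars

variable {k : ℕ} {σ R : Set (VertexSep G)} {s u : VertexSep G}

theorem interior_insert_inv (u : VertexSep G) (R : Set (VertexSep G)) :
    ⋂ s ∈ insert (inv u) R, s.B = u.A ∩ ⋂ r ∈ R, r.B :=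
  biInter_insert _ _ _

theorem IsStar.inter_subset_interior (hσ : IsStar σ) (hs : s ∈ σ) :
    s.A ∩ s.B ⊆ ⋂ t ∈ σ, t.B := by
  rintro v ⟨hA, hB⟩
  refine mem_iInter₂.2 fun t ht => ?_
  by_cases h : s = t
  · exact h ▸ hB
  · exact (hσ.2 s hs t ht h).1 hA

theorem inv_mem_sepsLT (hs : s ∈ sepsLT G k) : inv s ∈ sepsLT G k := by
  simpa only [sepsLT, mem_ofPred_eq, VertexSep.order_inv] using hs

theorem isSeparable_sepsLT [Finite V] : IsSeparable (sepsLT G k) :=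
  isSeparable_of_submodular VertexSep.order VertexSep.order_inv
    VertexSep.order_inf_add_order_sup_le k

theorem isStandard_forbiddenStars : IsStandard (sepsLT G k) (forbiddenStars G k) := by
  refine fun s hs hle =>
    ⟨singleton_subset_iff.2 (inv_mem_sepsLT hs), ⟨singleton_nonempty _, ?_⟩, ?_⟩
  · rintro _ rfl _ rfl hne
    exact absurd rfl hne
  · rw [biInter_singleton, VertexSep.inv_B, ← inter_eq_left.2 hle.1]
    exact hs

theorem IsStar.shift (x : VertexSep G) (hle : ∀ r ∈ R, r ≤ u) (h : IsStar (insert (inv u) R)) :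
    IsStar (insert (inv (u ⊓ inv x)) ((· ⊓ inv x) '' R)) := by
  refine ⟨insert_nonempty _ _, ?_⟩
  rintro _ (rfl | ⟨r, hr, rfl⟩) _ (rfl | ⟨t, ht, rfl⟩) hne
  · exact absurd rfl hne
  · exact inv_le_inv (inf_le_inf_right _ (hle t ht))
  · exact (inf_le_inf_right _ (hle r hr)).trans_eq (SeparationSystem.inv_inv _).symm
  · exact inf_le_left.trans ((h.2 r (.inr hr) t (.inr ht) fun hrt => hne (by rw [hrt])).trans
      (inv_le_inv inf_le_left))

theorem isClosedUnderShifting_forbiddenStars :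
    IsClosedUnderShifting (sepsLT G k) (forbiddenStars G k) := by
  intro s x hx u R hu hle hσ
  have shift_mem : ∀ w ∈ sepsLT G k, w ≤ inv s → w ⊓ inv x ∈ sepsLT G k := hx.2
  refine ⟨insert_subset (inv_mem_sepsLT (shift_mem u ?_ hu)) ?_, hσ.2.1.shift x hle, ?_⟩
  · exact SeparationSystem.inv_inv u ▸ inv_mem_sepsLT (hσ.1 (mem_insert _ _))
  · rintro _ ⟨r, hr, rfl⟩
    exact shift_mem r (hσ.1 (.inr hr)) ((hle r hr).trans hu)
  · have hinterior := hσ.2.2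
    rw [interior_insert_inv] at hinterior ⊢
    have hmem := shift_mem (VertexSep.ofStar u R hle) hinterior
      ⟨hu.1, subset_iInter₂ fun r hr => ((hle r hr).trans hu).2⟩
    rw [biInter_image]
    simp only [VertexSep.inf_B, ← iInter₂_union]
    exact hmem

end ForbiddenStars

end VertexSep

/-! ### Connected sets and vertex separations -/

section Connected

variable {V : Type*} {G : SimpleGraph V} {C D X : Set V} {v w x : V}

/-- The greatest vertex separation with first side disjoint from `C`: its second side consists of
`C` and the neighbours of `C`. -/
def towards (G : SimpleGraph V) (C : Set V) : VertexSep G where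
  A := Cᶜ
  B := C ∪ {w | ∃ c ∈ C, G.Adj c w}
  union_eq := by rw [← union_assoc, compl_union_self, univ_union]
  not_adj := by
    rintro a ⟨-, ha⟩ b ⟨-, hb⟩ hab
    exact ha (.inr ⟨b, notMem_compl_iff.1 hb, hab.symm⟩)

theorem le_towards_iff {s : VertexSep G} : s ≤ towards G C ↔ Disjoint C s.A := by
  refine ⟨fun h => disjoint_left.2 fun v hv hA => h.1 hA hv, fun h => ?_⟩
  rw [disjoint_left] at h
  refine ⟨fun v hA hv => h hv hA, ?_⟩
  rintro v (hv | ⟨c, hc, hcv⟩)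
  · exact s.mem_B_of_notMem_A (h hv)
  · exact VertexSep.mem_A_of_adj (inv s) (h hc) hcv

theorem inv_towards_le_towards_iff : inv (towards G D) ≤ towards G C ↔ ¬ Touch G C D := by
  rw [le_towards_iff, VertexSep.inv_A, towards, disjoint_union_right, disjoint_iff_inter_eq_empty,
    disjoint_left, Touch, not_or, not_nonempty_iff_eq_empty]
  simp only [mem_ofPred_eq, not_exists, not_and, G.adj_comm]

theorem disjoint_A_or_disjoint_B (hC : (G.induce C).Preconnected) {s : VertexSep G}
    (h : Disjoint C (s.A ∩ s.B)) : Disjoint C s.A ∨ Disjoint C s.B := by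
  have notMem : ∀ v ∈ C, v ∈ s.A → v ∉ s.B := fun v hv hA hB => disjoint_left.1 h hv ⟨hA, hB⟩
  by_contra! hcon
  obtain ⟨⟨a, ha, haA⟩, b, hb, hbB⟩ := hcon.imp not_disjoint_iff.1 not_disjoint_iff.1
  obtain ⟨p⟩ := hC ⟨a, ha⟩ ⟨b, hb⟩
  obtain ⟨d, -, hfst, hsnd⟩ := p.exists_boundary_dart {v | v.1 ∈ s.A} haA
    fun hbA => notMem b hb hbA hbB
  exact hsnd (s.mem_A_of_adj (notMem _ d.fst.2 hfst) d.adj)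

/-- The vertex set of the component of `v` in the graph `G - X`; it is empty if `v` lies in `X`. -/
def componentAvoiding (G : SimpleGraph V) (X : Set V) (v : V) : Set V :=
  {w | ∃ p : G.Walk v w, ∀ x ∈ p.support, x ∉ X}

theorem mem_componentAvoiding_self (hv : v ∉ X) : v ∈ componentAvoiding G X v :=
  ⟨.nil, by simpa using hv⟩

theorem notMem_of_mem_componentAvoiding (hw : w ∈ componentAvoiding G X v) : w ∉ X :=
  let ⟨p, hp⟩ := hw
  hp w p.end_mem_support

theorem mem_componentAvoiding_symm (hw : w ∈ componentAvoiding G X v) :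
    v ∈ componentAvoiding G X w := by
  obtain ⟨p, hp⟩ := hw
  exact ⟨p.reverse, fun x hx => hp x (by simpa using hx)⟩

theorem mem_componentAvoiding_trans (hw : w ∈ componentAvoiding G X v)
    (hx : x ∈ componentAvoiding G X w) : x ∈ componentAvoiding G X v := by
  obtain ⟨p, hp⟩ := hw
  obtain ⟨q, hq⟩ := hx
  refine ⟨p.append q, fun y hy => ?_⟩
  rcases SimpleGraph.Walk.mem_support_append_iff _ _ |>.1 hy with hy | hy
  exacts [hp y hy, hq y hy]

theorem mem_componentAvoiding_of_adj (hw : w ∈ componentAvoiding G X v) (hwx : G.Adj w x)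
    (hx : x ∉ X) : x ∈ componentAvoiding G X v :=
  mem_componentAvoiding_trans hw
    ⟨hwx.toWalk, by simpa using ⟨notMem_of_mem_componentAvoiding hw, hx⟩⟩

theorem mem_componentAvoiding_map {W : Type*} {H : SimpleGraph W} {Y : Set W} (f : G →g H)
    (hf : ∀ x ∉ X, f x ∉ Y) (hw : w ∈ componentAvoiding G X v) :
    f w ∈ componentAvoiding H Y (f v) := by
  obtain ⟨p, hp⟩ := hw
  refine ⟨p.map f, fun y hy => ?_⟩
  rw [SimpleGraph.Walk.support_map, List.mem_map] at hy
  obtain ⟨x, hx, rfl⟩ := hy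
  exact hf x (hp x hx)

theorem componentAvoiding_eq_of_touch
    (h : Touch G (componentAvoiding G X v) (componentAvoiding G X w)) :
    componentAvoiding G X v = componentAvoiding G X w := by
  have hvw : v ∈ componentAvoiding G X w := by
    rcases h with ⟨x, hxv, hxw⟩ | ⟨c, hc, d, hd, hcd⟩
    · exact mem_componentAvoiding_trans hxw (mem_componentAvoiding_symm hxv)
    · exact mem_componentAvoiding_trans (mem_componentAvoiding_of_adj hd hcd.symm
        (notMem_of_mem_componentAvoiding hc)) (mem_componentAvoiding_symm hc)
  ext x
  exact ⟨mem_componentAvoiding_trans hvw,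
    mem_componentAvoiding_trans (mem_componentAvoiding_symm hvw)⟩

theorem connected_induce_componentAvoiding (hv : v ∉ X) :
    (G.induce (componentAvoiding G X v)).Connected := by
  classical
  refine SimpleGraph.induce_connected_of_patches v (mem_componentAvoiding_self hv) ?_
  rintro w ⟨p, hp⟩
  exact ⟨{x | x ∈ p.support},
    fun x hx => ⟨p.takeUntil x hx, fun y hy => hp y (p.support_takeUntil_subset_support hx hy)⟩,
    p.start_mem_support, p.end_mem_support, p.connected_induce_support.preconnected _ _⟩

theorem order_towards_componentAvoiding_le (hX : X.Finite) :
    (towards G (componentAvoiding G X v)).order ≤ X.ncard := by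
  refine ncard_le_ncard ?_ hX
  rintro w ⟨hw, hw' | ⟨c, hc, hcw⟩⟩
  · exact absurd hw' hw
  · by_contra hwX
    exact hw (mem_componentAvoiding_of_adj hc hcw hwX)

end Connected

/-! ### Brambles and tangles -/

section Brambles

variable {V : Type*} {G : SimpleGraph V} {k : ℕ} {ℬ : Set (Set V)} {O : Set (VertexSep G)}
  {X : Set V}

theorem exists_disjoint_of_ncard_lt_brambleOrder (hX : X.ncard < brambleOrder ℬ) :
    ∃ C ∈ ℬ, Disjoint C X := by
  by_contra! hcon
  exact hX.not_ge (Nat.sInf_le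
    ⟨X, fun C hC => inter_comm X C ▸ not_disjoint_iff_nonempty_inter.1 (hcon C hC), rfl⟩)

/-- The separations in `S_k` that point to some element of `ℬ`. -/
def pointingTo (G : SimpleGraph V) (k : ℕ) (ℬ : Set (Set V)) : Set (VertexSep G) :=
  {s ∈ sepsLT G k | ∃ C ∈ ℬ, s ≤ towards G C}

theorem IsBramble.inv_notMem_pointingTo (hℬ : IsBramble G ℬ) {s : VertexSep G}
    (hs : s ∈ pointingTo G k ℬ) : inv s ∉ pointingTo G k ℬ := by
  obtain ⟨-, C, hC, hsC⟩ := hs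
  rintro ⟨-, D, hD, hsD⟩
  exact inv_towards_le_towards_iff.1 ((inv_le_comm.1 hsD).trans hsC) (hℬ.2 C hC D hD)

theorem IsBramble.isTangle (hℬ : IsBramble G ℬ) (hk : k ≤ brambleOrder ℬ) :
    IsTangle (sepsLT G k) (forbiddenStars G k) (pointingTo G k ℬ) := by
  refine IsLowerIn.isTangle ⟨fun s hs => hs.1, ?_⟩ (fun s hs => ?_)
    (fun s hs => hℬ.inv_notMem_pointingTo hs) ?_
  · rintro p ⟨-, C, hC, hpC⟩ q hq hqp
    exact ⟨hq, C, hC, hqp.trans hpC⟩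
  · obtain ⟨C, hC, hCs⟩ := exists_disjoint_of_ncard_lt_brambleOrder (lt_of_lt_of_le hs hk)
    exact (disjoint_A_or_disjoint_B (hℬ.1 C hC).preconnected hCs).imp
      (fun h => ⟨hs, C, hC, le_towards_iff.2 h⟩)
      (fun h => ⟨inv_mem_sepsLT hs, C, hC, le_towards_iff.2 h⟩)
  · rintro σ hσO ⟨hσ, hstar, hinterior⟩
    obtain ⟨C, hC, hCσ⟩ := exists_disjoint_of_ncard_lt_brambleOrder (hinterior.trans_le hk)
    obtain ⟨c, hc⟩ := (hℬ.1 C hC).nonempty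
    obtain ⟨s, hs, hcs⟩ : ∃ s ∈ σ, c ∉ s.B := by
      simpa only [mem_iInter, not_forall, exists_prop] using disjoint_left.1 hCσ hc
    have hCB : Disjoint C s.B :=
      (disjoint_A_or_disjoint_B (hℬ.1 C hC).preconnected
        (hCσ.mono_right (hstar.inter_subset_interior hs))).resolve_left
        fun h => disjoint_left.1 h hc (s.mem_A_of_notMem_B hcs)
    exact hℬ.inv_notMem_pointingTo (hσO hs)
      ⟨inv_mem_sepsLT (hσ hs), C, hC, le_towards_iff.2 hCB⟩

/-- The connected vertex sets to which a tangle `O` points. -/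
def tangleBramble (O : Set (VertexSep G)) : Set (Set V) :=
  {C | (G.induce C).Connected ∧ towards G C ∈ O}

theorem IsTangle.isBramble (hO : IsTangle (sepsLT G k) (forbiddenStars G k) O) :
    IsBramble G (tangleBramble O) := by
  refine ⟨fun C hC => hC.1, fun C hC D hD => ?_⟩
  by_contra h
  exact hO.not_le isStandard_forbiddenStars (fun _ => inv_mem_sepsLT) hD.2 hC.2
    (inv_towards_le_towards_iff.2 h)

/-- The star that consists of `(X, V)` and the separations that point away from the components of
`G - X`. Without `(X, V)` it would be empty for `X = V`. -/
def starOfComponents (G : SimpleGraph V) (X : Set V) : Set (VertexSep G) :=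
  insert ⟨X, univ, union_univ X, by simp⟩
    ((fun v => inv (towards G (componentAvoiding G X v))) '' Xᶜ)

theorem isStar_starOfComponents : IsStar (starOfComponents G X) := by
  have hdisj : ∀ v, Disjoint X (componentAvoiding G X v) := fun v =>
    disjoint_right.2 fun _ => notMem_of_mem_componentAvoiding
  refine ⟨insert_nonempty _ _, ?_⟩
  rintro _ (rfl | ⟨v, -, rfl⟩) _ (rfl | ⟨w, -, rfl⟩) hne
  · exact absurd rfl hne
  · exact ⟨(hdisj w).subset_compl_right, subset_univ _⟩
  · exact ⟨subset_univ _, (hdisj v).subset_compl_right⟩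
  · exact inv_towards_le_towards_iff.2 fun h => hne <|
      congrArg (fun C => inv (towards G C)) (componentAvoiding_eq_of_touch h).symm

theorem starOfComponents_mem_forbiddenStars [Finite V] (hX : X.ncard < k) :
    starOfComponents G X ∈ forbiddenStars G k := by
  refine ⟨insert_subset ?_ ?_, isStar_starOfComponents, ?_⟩
  · simpa [sepsLT, VertexSep.order] using hX
  · rintro _ ⟨v, -, rfl⟩
    exact inv_mem_sepsLT ((order_towards_componentAvoiding_le X.toFinite).trans_lt hX)
  · refine (ncard_le_ncard (fun v hv => ?_) X.toFinite).trans_lt hX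
    by_contra hvX
    exact mem_iInter₂.1 hv _ (.inr ⟨v, hvX, rfl⟩) (mem_componentAvoiding_self hvX)

theorem IsTangle.exists_disjoint_mem_tangleBramble [Finite V]
    (hO : IsTangle (sepsLT G k) (forbiddenStars G k) O) (hX : X.ncard < k) :
    ∃ C ∈ tangleBramble O, Disjoint C X := by
  by_contra! hcon
  refine hO.2.2 _ (insert_subset ?_ ?_) (starOfComponents_mem_forbiddenStars hX)
  · refine hO.mem_of_le_inv isStandard_forbiddenStars (fun _ => inv_mem_sepsLT) ?_
      ⟨subset_univ X, subset_univ X⟩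
    simpa [sepsLT, VertexSep.order] using hX
  · rintro _ ⟨v, hv, rfl⟩
    refine (hO.1.mem_or_inv_mem ?_).resolve_left fun h => ?_
    · exact (order_towards_componentAvoiding_le X.toFinite).trans_lt hX
    · exact hcon _ ⟨connected_induce_componentAvoiding hv, h⟩
        (disjoint_left.2 fun _ => notMem_of_mem_componentAvoiding)

theorem IsTangle.le_brambleOrder [Finite V] (hO : IsTangle (sepsLT G k) (forbiddenStars G k) O) :
    k ≤ brambleOrder (tangleBramble O) := by
  refine le_csInf ⟨_, _, hO.isBramble.covers_univ, rfl⟩ ?_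
  rintro _ ⟨X, hX, rfl⟩
  by_contra! hlt
  obtain ⟨C, hC, hCX⟩ := hO.exists_disjoint_mem_tangleBramble hlt
  exact not_disjoint_iff_nonempty_inter.2 (hX C hC) hCX.symm

end Brambles

/-! ### Gluing trees -/

section Trees

variable {M N : Type*} {S : SimpleGraph M} {T : SimpleGraph N}

/-- The map `f` contracts all edges of `T` outside the copy of `S`, so a walk in `T` projects to a
walk in `S` all of whose edges it already uses. -/
theorem exists_walk_of_retraction (ι : M → N) (f : N → M)
    (hf : ∀ x y, T.Adj x y → f x = f y ∨ S.Adj (f x) (f y) ∧ ι (f x) = x ∧ ι (f y) = y)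
    {x y : N} (p : T.Walk x y) :
    ∃ q : S.Walk (f x) (f y), ∀ e ∈ q.edges, e.map ι ∈ p.edges := by
  induction p with
  | nil => exact ⟨.nil, by simp⟩
  | @cons x y z hxy p ih =>
    obtain ⟨q, hq⟩ := ih
    rcases hf x y hxy with h | ⟨h, hx, hy⟩
    · exact ⟨q.copy h.symm rfl, fun e he => .tail _ (hq e (by simpa using he))⟩
    · refine ⟨.cons h q, fun e he => ?_⟩
      rw [SimpleGraph.Walk.edges_cons, List.mem_cons] at he ⊢
      refine he.imp ?_ (hq e)
      rintro rfl
      rw [Sym2.map_mk, hx, hy]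

theorem isBridge_of_retraction {ι : M → N} {f : N → M} (hι : Function.LeftInverse f ι)
    (hf : ∀ x y, T.Adj x y → f x = f y ∨ S.Adj (f x) (f y) ∧ ι (f x) = x ∧ ι (f y) = y)
    {u v : M} (h : S.IsBridge s(u, v)) : T.IsBridge s(ι u, ι v) := by
  rw [SimpleGraph.isBridge_iff_forall_walk_mem_edges] at h ⊢
  intro p
  obtain ⟨q, hq⟩ := exists_walk_of_retraction ι f hf p
  rw [← Sym2.map_mk]
  exact hq _ (by simpa using h (q.copy (hι u) (hι v)))

theorem isAcyclic_sum (hS : S.IsAcyclic) (hT : T.IsAcyclic) : (S ⊕g T).IsAcyclic := by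
  rw [SimpleGraph.isAcyclic_iff_forall_adj_isBridge] at hS hT ⊢
  rintro (u | u) (v | v) h
  · refine isBridge_of_retraction (f := Sum.elim id fun _ => u) (fun _ => rfl) ?_
      (hS (SimpleGraph.sum_adj_inl.1 h))
    rintro (x | x) (y | y) <;> simp +contextual
  · simp at h
  · simp at h
  · refine isBridge_of_retraction (f := Sum.elim (fun _ => u) id) (fun _ => rfl) ?_
      (hT (SimpleGraph.sum_adj_inr.1 h))
    rintro (x | x) (y | y) <;> simp +contextual

theorem isTree_sum_sup_edge (hS : S.IsTree) (hT : T.IsTree) (a : M) (b : N) :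
    ((S ⊕g T) ⊔ SimpleGraph.edge (Sum.inl a) (Sum.inr b)).IsTree :=
  ⟨hS.connected.sum_sup_edge hT.connected,
    SimpleGraph.IsAcyclic.sup_edge_of_not_reachable (SimpleGraph.not_reachable_sum_inl_inr _ _)
      (isAcyclic_sum hS.isAcyclic hT.isAcyclic)⟩

end Trees

/-! ### Gluing tree-decompositions -/

section Gluing

variable {V : Type*} {G : SimpleGraph V} {k : ℕ} {A B X Y : Set V}

/-- A tree-decomposition of `G[A]` with parts in `V`. That the parts containing a given vertex form
a subtree is expressed by walks in `T` that stay in these parts. -/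
structure TreeDecompositionOn (G : SimpleGraph V) (A : Set V) {N : Type*} (T : SimpleGraph N) where
  isTree : T.IsTree
  bag : N → Set V
  bag_subset : ∀ t, bag t ⊆ A
  exists_mem_bag : ∀ v ∈ A, ∃ t, v ∈ bag t
  exists_edge_bag : ∀ u ∈ A, ∀ v ∈ A, G.Adj u v → ∃ t, u ∈ bag t ∧ v ∈ bag t
  mem_componentAvoiding : ∀ v t t', v ∈ bag t → v ∈ bag t' →
    t' ∈ componentAvoiding T {n | v ∉ bag n} t

/-- The tree-decomposition of `G[A ∪ B]` obtained from tree-decompositions of `G[A]` and `G[B]` by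
joining two nodes whose parts contain `A ∩ B`. -/
def TreeDecompositionOn.glue {M N : Type*} {S : SimpleGraph M} {T : SimpleGraph N}
    (D : TreeDecompositionOn G A S) (E : TreeDecompositionOn G B T) {m : M} {n : N}
    (hm : A ∩ B ⊆ D.bag m) (hn : A ∩ B ⊆ E.bag n)
    (hadj : ∀ a ∈ A \ B, ∀ b ∈ B \ A, ¬ G.Adj a b) :
    TreeDecompositionOn G (A ∪ B) ((S ⊕g T) ⊔ SimpleGraph.edge (Sum.inl m) (Sum.inr n)) where
  isTree := isTree_sum_sup_edge D.isTree E.isTree m n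
  bag := Sum.elim D.bag E.bag
  bag_subset := by
    rintro (a | b)
    exacts [(D.bag_subset a).trans subset_union_left, (E.bag_subset b).trans subset_union_right]
  exists_mem_bag := by
    rintro v (hv | hv)
    · exact (D.exists_mem_bag v hv).imp' Sum.inl fun _ => id
    · exact (E.exists_mem_bag v hv).imp' Sum.inr fun _ => id
  exists_edge_bag := by
    intro u hu v hv huv
    by_cases hA : u ∈ A ∧ v ∈ A
    · exact (D.exists_edge_bag u hA.1 v hA.2 huv).imp' Sum.inl fun _ => id
    by_cases hB : u ∈ B ∧ v ∈ B
    · exact (E.exists_edge_bag u hB.1 v hB.2 huv).imp' Sum.inr fun _ => id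
    rcases hu with hu | hu <;> rcases hv with hv | hv
    · exact absurd ⟨hu, hv⟩ hA
    · exact absurd huv (hadj u ⟨hu, fun h => hB ⟨h, hv⟩⟩ v ⟨hv, fun h => hA ⟨hu, h⟩⟩)
    · exact absurd huv.symm (hadj v ⟨hv, fun h => hB ⟨hu, h⟩⟩ u ⟨hu, fun h => hA ⟨h, hv⟩⟩)
    · exact absurd ⟨hu, hv⟩ hB
  mem_componentAvoiding := by
    intro v
    let U := (S ⊕g T) ⊔ SimpleGraph.edge (Sum.inl m) (Sum.inr n)
    let inl : S →g U := ⟨Sum.inl, fun h => .inl (SimpleGraph.sum_adj_inl.2 h)⟩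
    let inr : T →g U := ⟨Sum.inr, fun h => .inl (SimpleGraph.sum_adj_inr.2 h)⟩
    let avoid : Set (M ⊕ N) := {c | v ∉ Sum.elim D.bag E.bag c}
    have left : ∀ a a', v ∈ D.bag a → v ∈ D.bag a' →
        inl a' ∈ componentAvoiding U avoid (inl a) := fun a a' ha ha' =>
      mem_componentAvoiding_map inl (fun _ => id) (D.mem_componentAvoiding v a a' ha ha')
    have right : ∀ b b', v ∈ E.bag b → v ∈ E.bag b' →
        inr b' ∈ componentAvoiding U avoid (inr b) := fun b b' hb hb' =>
      mem_componentAvoiding_map inr (fun _ => id) (E.mem_componentAvoiding v b b' hb hb')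
    have cross : ∀ a b, v ∈ D.bag a → v ∈ E.bag b →
        inr b ∈ componentAvoiding U avoid (inl a) := by
      intro a b ha hb
      have hvm : v ∈ D.bag m := hm ⟨D.bag_subset a ha, E.bag_subset b hb⟩
      have hvn : v ∈ E.bag n := hn ⟨D.bag_subset a ha, E.bag_subset b hb⟩
      have hadj : U.Adj (inl m) (inr n) := .inr (by simp [SimpleGraph.edge_adj, inl, inr])
      exact mem_componentAvoiding_trans
        (mem_componentAvoiding_of_adj (left a m ha hvm) hadj (not_not.2 hvn)) (right n b hvn hb)
    rintro (a | a) (b | b) ha hb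
    exacts [left a b ha hb, cross a b ha hb, mem_componentAvoiding_symm (cross b a hb ha),
      right a b ha hb]

/-- A tree-decomposition of `G[V]` as one of `G`: in a tree, the path between two nodes is contained
in every walk between them. -/
def TreeDecompositionOn.toTreeDecomposition {N : Type*} {T : SimpleGraph N}
    (D : TreeDecompositionOn G univ T) : TreeDecomposition G T where
  isTree := D.isTree
  bag := D.bag
  exists_mem_bag v := D.exists_mem_bag v trivial
  exists_edge_bag u v := D.exists_edge_bag u trivial v trivial
  inter_subset := by
    classical
    rintro t₁ t₂ t₃ p hp ht₂ v ⟨h₁, h₃⟩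
    obtain ⟨q, hq⟩ := D.mem_componentAvoiding v t₁ t₃ h₁ h₃
    have hpq : p = q.bypass := (D.isTree.existsUnique_path t₁ t₃).unique hp q.bypass_isPath
    exact not_not.1 (hq t₂ (q.support_bypass_subset_support (hpq ▸ ht₂)))

/-- `G[A]` has a tree-decomposition into parts of size less than `k`, one of which contains
`X`. -/
def HasSmallTreeDecomposition (G : SimpleGraph V) (k : ℕ) (A X : Set V) : Prop :=
  ∃ (N : Type) (_ : Fintype N) (T : SimpleGraph N) (D : TreeDecompositionOn G A T),
    (∀ t, (D.bag t).ncard < k) ∧ ∃ t, X ⊆ D.bag t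

theorem HasSmallTreeDecomposition.of_ncard_lt (h : A.ncard < k) :
    HasSmallTreeDecomposition G k A A :=
  ⟨Unit, inferInstance, ⊥,
    { isTree := SimpleGraph.IsTree.of_subsingleton
      bag := fun _ => A
      bag_subset := fun _ => subset_rfl
      exists_mem_bag := fun _ hv => ⟨(), hv⟩
      exists_edge_bag := fun _ hu _ hv _ => ⟨(), hu, hv⟩
      mem_componentAvoiding := fun _ _ _ hv _ => mem_componentAvoiding_self (not_not.2 hv) },
    fun _ => h, (), subset_rfl⟩

theorem HasSmallTreeDecomposition.mono (h : HasSmallTreeDecomposition G k A X) (hYX : Y ⊆ X) :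
    HasSmallTreeDecomposition G k A Y := by
  obtain ⟨N, inferInstance, T, D, hD, t, ht⟩ := h
  exact ⟨N, inferInstance, T, D, hD, t, hYX.trans ht⟩

theorem HasSmallTreeDecomposition.glue (hA : HasSmallTreeDecomposition G k A X)
    (hB : HasSmallTreeDecomposition G k B Y) (hX : A ∩ B ⊆ X) (hY : A ∩ B ⊆ Y)
    (hadj : ∀ a ∈ A \ B, ∀ b ∈ B \ A, ¬ G.Adj a b) : HasSmallTreeDecomposition G k (A ∪ B) X := by
  obtain ⟨M, _, S, D, hD, m, hm⟩ := hA
  obtain ⟨N, _, T, E, hE, n, hn⟩ := hB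
  refine ⟨M ⊕ N, inferInstance, _, D.glue E (hX.trans hm) (hY.trans hn) hadj, ?_, .inl m, hm⟩
  rintro (a | b)
  exacts [hD a, hE b]

/-- The first sides of a star are glued one by one to a part that consists of its interior. -/
theorem HasSmallTreeDecomposition.glue_star {σ R : Set (VertexSep G)} (hσ : IsStar σ)
    (hinterior : (⋂ s ∈ σ, s.B).ncard < k) (hfin : R.Finite) (hRσ : R ⊆ σ)
    (hR : ∀ r ∈ R, HasSmallTreeDecomposition G k r.A (r.A ∩ r.B)) :
    HasSmallTreeDecomposition G k ((⋂ s ∈ σ, s.B) ∪ ⋃ r ∈ R, r.A) (⋂ s ∈ σ, s.B) := by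
  induction R, hfin using Set.Finite.induction_on with
  | empty => simpa using HasSmallTreeDecomposition.of_ncard_lt hinterior
  | @insert r R hr _ ih =>
    replace ih := ih ((subset_insert r R).trans hRσ) fun t ht => hR t (.inr ht)
    have hrσ : r ∈ σ := hRσ (mem_insert r R)
    have hB : (⋂ s ∈ σ, s.B) ∪ ⋃ t ∈ R, t.A ⊆ r.B :=
      union_subset (biInter_subset_of_mem hrσ) <| iUnion₂_subset fun t ht =>
        (hσ.2 t (hRσ (.inr ht)) r hrσ fun h => hr (h ▸ ht)).1
    have hAB : r.A ∩ r.B ⊆ ⋂ s ∈ σ, s.B := hσ.inter_subset_interior hrσ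
    have hmeet : ((⋂ s ∈ σ, s.B) ∪ ⋃ t ∈ R, t.A) ∩ r.A ⊆ r.A ∩ r.B := fun v hv => ⟨hv.2, hB hv.1⟩
    rw [biUnion_insert, union_comm r.A, ← union_assoc]
    refine ih.glue (hR r (mem_insert r R)) (hmeet.trans hAB) hmeet ?_
    rintro a ⟨ha, haA⟩ b ⟨hb, hb'⟩ hab
    exact r.not_adj b ⟨hb, fun hbB => hb' (.inl (hAB ⟨hb, hbB⟩))⟩ a ⟨hB ha, haA⟩ hab.symm

theorem VertexSep.interior_union_eq_A {u : VertexSep G} {R : Set (VertexSep G)}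
    (hle : ∀ r ∈ R, r ≤ u) : (⋂ s ∈ insert (inv u) R, s.B) ∪ ⋃ r ∈ R, r.A = u.A := by
  rw [interior_insert_inv]
  refine subset_antisymm (union_subset inter_subset_left (iUnion₂_subset fun r hr => (hle r hr).1))
    fun v hv => ?_
  by_cases h : v ∈ ⋂ r ∈ R, r.B
  · exact .inl ⟨hv, h⟩
  · simp only [mem_iInter, not_forall] at h
    obtain ⟨r, hr, hvr⟩ := h
    exact .inr (mem_iUnion₂.2 ⟨r, hr, r.mem_A_of_notMem_B hvr⟩)

theorem Decomposable.hasSmallTreeDecomposition [Finite V] {u : VertexSep G}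
    (h : Decomposable (forbiddenStars G k) ∅ u) :
    HasSmallTreeDecomposition G k u.A (u.A ∩ u.B) := by
  induction h with
  | of_mem hu => exact hu.elim
  | @of_star u R _ hle hσ ih =>
    have := HasSmallTreeDecomposition.glue_star hσ.2.1 hσ.2.2 R.toFinite (subset_insert _ R) ih
    rw [VertexSep.interior_union_eq_A hle, interior_insert_inv] at this
    exact this.mono (inter_subset_inter_right _ (subset_iInter₂ fun r hr => (hle r hr).2))

theorem HasSmallTreeDecomposition.treeWidth_lt (h : HasSmallTreeDecomposition G k univ X)
    (hk : 0 < k) : treeWidth G < k - 1 := by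
  obtain ⟨N, _, T, D, hD, -⟩ := h
  refine (csInf_le (bddBelow_widths G)
    ⟨N, inferInstance, T, D.toTreeDecomposition, rfl⟩).trans_lt ?_
  have : (Finset.univ.sup fun t => (D.toTreeDecomposition.bag t).ncard) < k :=
    (Finset.sup_lt_iff hk).2 fun t _ => hD t
  simp only [TreeDecomposition.width]
  omega

theorem IsDecomposing.treeWidth_lt [Finite V] (hk : 0 < k)
    (h : IsDecomposing (forbiddenStars G k) ∅) : treeWidth G < k - 1 := by
  obtain ⟨r, hA, hB⟩ := h
  have := hA.hasSmallTreeDecomposition.glue hB.hasSmallTreeDecomposition subset_rfl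
    (inter_comm _ _).subset r.not_adj
  rw [VertexSep.inv_A, r.union_eq] at this
  exact this.treeWidth_lt hk

theorem exists_isTangle_of_le_treeWidth [Finite V] (hk : 0 < k) (h : (k : ℤ) - 1 ≤ treeWidth G) :
    ∃ O, IsTangle (sepsLT G k) (forbiddenStars G k) O :=
  exists_isTangle (sepsLT G k).toFinite (fun _ => inv_mem_sepsLT) isSeparable_sepsLT
    (fun _ hσ => hσ.2.1) isStandard_forbiddenStars
    isClosedUnderShifting_forbiddenStars fun hdec => (hdec.treeWidth_lt hk).not_ge h

end Gluing

/-! ### Cutting along the edges of a decomposition tree -/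

section Branches

variable {N : Type*} {T : SimpleGraph N} {x x' y t n m : N}

theorem mem_componentAvoiding_or_mem_componentAvoiding (hT : T.Connected) (hxy : T.Adj x y)
    (n : N) : n ∈ componentAvoiding T {y} x ∨ n ∈ componentAvoiding T {x} y := by
  obtain ⟨p⟩ := hT.preconnected n x
  induction p with
  | nil => exact .inl (mem_componentAvoiding_self hxy.ne)
  | @cons a b x hab _ ih =>
    by_cases hax : a = x
    · exact .inl (hax ▸ mem_componentAvoiding_self (hax ▸ hxy.ne))
    by_cases hay : a = y
    · exact .inr (hay ▸ mem_componentAvoiding_self (hay ▸ hax))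
    exact (ih hxy).imp (mem_componentAvoiding_of_adj · hab.symm hay)
      (mem_componentAvoiding_of_adj · hab.symm hax)

theorem mem_support_of_mem_componentAvoiding (hT : T.IsAcyclic) (hxy : T.Adj x y)
    (hn : n ∈ componentAvoiding T {y} x) (hm : m ∈ componentAvoiding T {x} y) (p : T.Walk n m) :
    x ∈ p.support ∧ y ∈ p.support := by
  obtain ⟨q, hq⟩ := hn
  obtain ⟨r, hr⟩ := mem_componentAvoiding_symm hm
  have bridge : T.IsBridge s(x, y) := SimpleGraph.isAcyclic_iff_forall_adj_isBridge.1 hT hxy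
  have hedge : s(x, y) ∈ (q.append (p.append r)).edges :=
    SimpleGraph.isBridge_iff_forall_walk_mem_edges.1 bridge _
  rw [SimpleGraph.Walk.edges_append, SimpleGraph.Walk.edges_append, List.mem_append,
    List.mem_append] at hedge
  rcases hedge with h | h | h
  · exact absurd rfl (hq y (q.snd_mem_support_of_mem_edges h))
  · exact ⟨p.fst_mem_support_of_mem_edges h, p.snd_mem_support_of_mem_edges h⟩
  · exact absurd rfl (hr x (r.fst_mem_support_of_mem_edges h))

theorem componentAvoiding_subset_of_adj (hT : T.IsTree) (hx : T.Adj x t) (hx' : T.Adj x' t)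
    (hne : x ≠ x') : componentAvoiding T {t} x ⊆ componentAvoiding T {x'} t := by
  intro n hn
  refine (mem_componentAvoiding_or_mem_componentAvoiding hT.connected hx' n).resolve_left
    fun hn' => ?_
  have hx'x : x' ∈ componentAvoiding T {t} x :=
    mem_componentAvoiding_trans hn (mem_componentAvoiding_symm hn')
  have hxmem : x ∈ hx'.toWalk.support := (mem_support_of_mem_componentAvoiding hT.isAcyclic hx
    hx'x (mem_componentAvoiding_self hx.ne') _).1
  have : x = x' ∨ x = t := by simpa using hxmem
  exact this.elim hne hx.ne

theorem exists_adj_mem_componentAvoiding (hT : T.Connected) (hne : n ≠ t) :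
    ∃ x, T.Adj x t ∧ n ∈ componentAvoiding T {t} x := by
  obtain ⟨p, hp⟩ := hT.exists_isPath t n
  cases p with
  | nil => exact absurd rfl hne
  | @cons _ x _ h q =>
    rw [SimpleGraph.Walk.cons_isPath_iff] at hp
    exact ⟨x, h.symm, q, fun y hy hyt => hp.2 (hyt ▸ hy)⟩

end Branches

section SepTrees

variable {V : Type*} {G : SimpleGraph V} {k : ℕ} {N : Type*} {T : SimpleGraph N}

/-- The separation of `G` associated with an oriented edge `e` of the decomposition tree: its sides
are the unions of the parts on the two sides of `e`. -/
def TreeDecomposition.sep (D : TreeDecomposition G T) (e : T.Dart) : VertexSep G where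
  A := ⋃ n ∈ componentAvoiding T {e.snd} e.fst, D.bag n
  B := ⋃ n ∈ componentAvoiding T {e.fst} e.snd, D.bag n
  union_eq := by
    refine eq_univ_of_forall fun v => ?_
    obtain ⟨n, hn⟩ := D.exists_mem_bag v
    exact (mem_componentAvoiding_or_mem_componentAvoiding D.isTree.connected e.adj n).imp
      (mem_biUnion · hn) (mem_biUnion · hn)
  not_adj := by
    rintro a ⟨-, ha⟩ b ⟨-, hb⟩ hab
    obtain ⟨n, hna, hnb⟩ := D.exists_edge_bag a b hab
    rcases mem_componentAvoiding_or_mem_componentAvoiding D.isTree.connected e.adj n with h | h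
    exacts [hb (mem_biUnion h hnb), ha (mem_biUnion h hna)]

theorem TreeDecomposition.sep_inter_subset (D : TreeDecomposition G T) (e : T.Dart) :
    (D.sep e).A ∩ (D.sep e).B ⊆ D.bag e.snd := by
  rintro v ⟨hA, hB⟩
  obtain ⟨n, hn, hvn⟩ := mem_iUnion₂.1 hA
  obtain ⟨m, hm, hvm⟩ := mem_iUnion₂.1 hB
  obtain ⟨p, hp⟩ := D.isTree.connected.exists_isPath n m
  exact D.inter_subset n e.snd m p hp
    (mem_support_of_mem_componentAvoiding D.isTree.isAcyclic e.adj hn hm p).2 ⟨hvn, hvm⟩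

theorem TreeDecomposition.isStar_image_sep [Nontrivial N] (D : TreeDecomposition G T) (t : N) :
    IsStar (D.sep '' {e | e.snd = t}) := by
  obtain ⟨n, hn⟩ := exists_ne t
  obtain ⟨z, hz, -⟩ := exists_adj_mem_componentAvoiding D.isTree.connected hn
  refine ⟨⟨_, ⟨(z, t), hz⟩, rfl, rfl⟩, ?_⟩
  rintro _ ⟨⟨⟨x, y⟩, hx⟩, rfl, rfl⟩ _ ⟨⟨⟨x', y'⟩, hx'⟩, hy, rfl⟩ hne
  obtain rfl : y' = y := hy
  have hxx' : x ≠ x' := by rintro rfl; exact hne rfl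
  exact ⟨biUnion_subset_biUnion_left (componentAvoiding_subset_of_adj D.isTree hx hx' hxx'),
    biUnion_subset_biUnion_left (componentAvoiding_subset_of_adj D.isTree hx' hx hxx'.symm)⟩

theorem TreeDecomposition.interior_image_sep_subset (D : TreeDecomposition G T) (t : N) :
    ⋂ s ∈ D.sep '' {e | e.snd = t}, s.B ⊆ D.bag t := by
  intro v hv
  obtain ⟨n, hn⟩ := D.exists_mem_bag v
  by_cases hnt : n = t
  · exact hnt ▸ hn
  obtain ⟨x, hx, hnx⟩ := exists_adj_mem_componentAvoiding D.isTree.connected hnt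
  let e : T.Dart := ⟨(x, t), hx⟩
  exact D.sep_inter_subset e ⟨mem_biUnion hnx hn, mem_iInter₂.1 hv _ ⟨e, rfl, rfl⟩⟩

theorem TreeDecomposition.hasSepTreeOver [Finite V] {N : Type} [Finite N] [Nontrivial N]
    {T : SimpleGraph N} (D : TreeDecomposition G T) (hD : ∀ t, (D.bag t).ncard < k) :
    HasSepTreeOver (sepsLT G k) (forbiddenStars G k) := by
  have hmem : ∀ e, D.sep e ∈ sepsLT G k := fun e =>
    (ncard_le_ncard (D.sep_inter_subset e)).trans_lt (hD _)
  obtain ⟨t, n, hne⟩ := exists_pair_ne N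
  obtain ⟨x, hx, -⟩ := exists_adj_mem_componentAvoiding D.isTree.connected hne.symm
  exact ⟨N, .ofFinite N, T, ⟨D.isTree, ⟨x, t, hx⟩, D.sep, hmem, fun _ => rfl⟩, fun t =>
    ⟨image_subset_iff.2 fun e _ => hmem e, D.isStar_image_sep t,
      (ncard_le_ncard (D.interior_image_sep_subset t)).trans_lt (hD t)⟩⟩

theorem hasSepTreeOver_of_ncard_univ_lt (h : (univ : Set V).ncard < k) :
    HasSepTreeOver (sepsLT G k) (forbiddenStars G k) := by
  let s : VertexSep G := ⟨univ, univ, union_self _, by simp⟩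
  have hs : s ∈ sepsLT G k := by simpa [sepsLT, VertexSep.order, s] using h
  have hT : (⊤ : SimpleGraph Bool).IsTree :=
    ⟨SimpleGraph.connected_top, .of_card_le_two (by simp)⟩
  refine ⟨Bool, inferInstance, ⊤, ⟨hT, ⟨true, false, by simp⟩, fun _ => s, fun _ => hs,
    fun _ => rfl⟩, fun t => ?_⟩
  have hne : {e : (⊤ : SimpleGraph Bool).Dart | e.snd = t}.Nonempty :=
    ⟨⟨(!t, t), by simp⟩, rfl⟩
  rw [SepTree.α, hne.image_const]
  exact ⟨singleton_subset_iff.2 hs, ⟨singleton_nonempty s, fun _ hr _ hr' hne =>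
    absurd (hr.trans hr'.symm) hne⟩, by simpa [s] using h⟩

theorem hasSepTreeOver_of_treeWidth_lt [Finite V] (h : treeWidth G < k - 1) :
    HasSepTreeOver (sepsLT G k) (forbiddenStars G k) := by
  obtain ⟨N, _, T, D, hD⟩ := Int.csInf_mem (nonempty_widths G) (bddBelow_widths G)
  have hbag : ∀ t, (D.bag t).ncard < k := by
    intro t
    have hwidth : D.width < k - 1 := hD.trans_lt h
    have hle := Finset.le_sup (f := fun t => (D.bag t).ncard) (Finset.mem_univ t)
    simp only [TreeDecomposition.width] at hwidth
    omega
  rcases subsingleton_or_nontrivial N with hN | hN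
  · obtain ⟨t⟩ := D.isTree.connected.nonempty
    have huniv : univ ⊆ D.bag t := fun v _ => by
      obtain ⟨n, hn⟩ := D.exists_mem_bag v
      exact Subsingleton.elim n t ▸ hn
    exact hasSepTreeOver_of_ncard_univ_lt ((ncard_le_ncard huniv).trans_lt (hbag t))
  · exact D.hasSepTreeOver hbag

end SepTrees

end TangleDuality

theorem mainTheorem3 {V : Type*} [Finite V] [Nonempty V] (G : SimpleGraph V)
    (k : ℕ) (hk : 0 < k) :
    List.TFAE [
      ∃ ℬ : Set (Set V), TangleDuality.IsBramble G ℬ ∧ k ≤ TangleDuality.brambleOrder ℬ,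
      ∃ O : Set (TangleDuality.VertexSep G),
        TangleDuality.IsTangle (TangleDuality.sepsLT G k) (TangleDuality.forbiddenStars G k) O,
      ¬ TangleDuality.HasSepTreeOver (TangleDuality.sepsLT G k)
        (TangleDuality.forbiddenStars G k),
      (k : ℤ) - 1 ≤ TangleDuality.treeWidth G] := by
  tfae_have 1 → 2 := fun ⟨_, hℬ, h⟩ => ⟨_, hℬ.isTangle h⟩
  tfae_have 2 → 1 := fun ⟨_, hO⟩ => ⟨_, hO.isBramble, hO.le_brambleOrder⟩
  tfae_have 2 → 3 := fun ⟨_, hO⟩ => hO.not_hasSepTreeOver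
  tfae_have 3 → 4 := fun h => not_lt.1 fun hlt =>
    h (TangleDuality.hasSepTreeOver_of_treeWidth_lt hlt)
  tfae_have 4 → 2 := TangleDuality.exists_isTangle_of_le_treeWidth hk
  tfae_finish
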